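/- Let $\{0,1\}^\omega$ be the set of infinite bit-strings, and let $V$ be the Thompson group, acting on the left on $\{0,1\}^\omega$ by prefix replacement: the elements of $V$ are the permutations $f$ of $\{0,1\}^\omega$ for which there are finite maximal prefix codes $P,Q\subseteq\{0,1\}^*$ and a bijection $\beta:P\to Q$ with $f(pt)=\beta(p)\,t$ for all $p\in P$, $t\in\{0,1\}^\omega$. Let $\Gamma\subseteq V$ be any finite monoid generating set of $V$ (a finite subset such that every element of $V$ is a product of a finite sequence of elements of $\Gamma$). A word $w=a_n\cdots a_1\in\Gamma^*$ (with $a_i\in\Gamma$) represents the element $w(\cdot)=a_n\circ\cdots\circ a_1$ of $V$, and the co-word-problem of $V$ over $\Gamma$ is $\mathsf{cowp}_\Gamma(V)=\{w\in\Gamma^*: w(\cdot)\neq 1_V\}$. For $z\in\{0,1\}^+$ define $$L_z=\{\,w\in\Gamma^+ : w(z0^\omega)\neq z0^\omega\,\}.$$ Then for every $z\in\{0,1\}^+$, $L_z\subseteq \mathsf{cowp}_\Gamma(V)$, and the reverse language $L_z^{\mathrm{rev}}=\{a_1\cdots a_n : a_n\cdots a_1\in L_z\}$ over the alphabet $\Gamma$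 is deterministic context-free, i.e. it is accepted, by final state and without an input endmarker, by a deterministic push-down automaton. -/

import Mathlib

/-! ### Prefix codes and the Thompson group `V` acting on the Cantor space -/

/-- The Cantor space `{0,1}^ω` of infinite bit-strings (`false` is `0`, `true` is `1`). -/
abbrev CantorSpace : Type := Stream' Bool

/-- A prefix code: no element is a strict prefix of another element. -/
def IsPrefixCode (P : Set (List Bool)) : Prop :=
  ∀ p ∈ P, ∀ q ∈ P, p <+: q → p = q

/-- A maximal prefix code: a prefix code over `{0,1}` that is not strictly contained in another
prefix code over `{0,1}`. -/
def IsMaximalPrefixCode (P : Set (List Bool)) : Prop :=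
  IsPrefixCode P ∧ ∀ R : Set (List Bool), IsPrefixCode R → P ⊆ R → R = P

/-- `f` is given by a finite table: there are finite maximal prefix codes `P`, `Q` and a bijection
`β : P → Q` such that `f` replaces a prefix `p ∈ P` by `β p`. -/
def HasPrefixTable (f : Equiv.Perm CantorSpace) : Prop :=
  ∃ P Q : Set (List Bool), P.Finite ∧ Q.Finite ∧ IsMaximalPrefixCode P ∧ IsMaximalPrefixCode Q ∧
    ∃ β : P ≃ Q, ∀ (p : P) (t : CantorSpace), f (p.1 ++ₛ t) = (β p).1 ++ₛ t

theorem isMaximalPrefixCode_iff (P : Set (List Bool)) :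
    IsMaximalPrefixCode P ↔
      IsPrefixCode P ∧ ∀ u : List Bool, ∃ p ∈ P, p <+: u ∨ u <+: p := by
  constructor
  · rintro ⟨h1, h2⟩
    refine ⟨h1, fun u => ?_⟩
    by_contra! hu
    have hR : IsPrefixCode (insert u P) := by
      rintro p (rfl | hp) q (rfl | hq) hpq
      · rfl
      · exact absurd hpq (hu q hq).2
      · exact absurd hpq (hu p hp).1
      · exact h1 p hp q hq hpq
    have hmem : u ∈ P := by
      rw [← h2 _ hR (Set.subset_insert u P)]
      exact Set.mem_insert u P
    exact (hu u hmem).1 (List.prefix_refl u)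
  · rintro ⟨h1, h2⟩
    refine ⟨h1, fun R hR hPR => Set.Subset.antisymm (fun u hu => ?_) hPR⟩
    obtain ⟨p, hp, h | h⟩ := h2 u
    · rwa [← hR p (hPR hp) u hu h]
    · rwa [hR u hu p (hPR hp) h]

theorem append_stream_take (n : ℕ) (x : CantorSpace) :
    ∃ (u : List Bool) (t : CantorSpace), u.length = n ∧ x = u ++ₛ t :=
  ⟨x.take n, x.drop n, by simp, (Stream'.append_take_drop n x).symm⟩

theorem prefix_of_append_stream_eq {u v : List Bool} {s t : CantorSpace}
    (h : u ++ₛ s = v ++ₛ t) (hl : u.length ≤ v.length) : u <+: v := by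
  induction u generalizing v with
  | nil => exact List.nil_prefix
  | cons a u ih =>
    cases v with
    | nil => simp at hl
    | cons b v =>
      rw [Stream'.cons_append_stream, Stream'.cons_append_stream] at h
      obtain ⟨h1, h2⟩ := Stream'.cons_injective2 h
      subst h1
      exact (List.prefix_cons_inj a).2 (ih h2 (by simpa using hl))

theorem hasPrefixTable_iff (f : Equiv.Perm CantorSpace) :
    HasPrefixTable f ↔ ∃ n : ℕ, ∀ u : List Bool, u.length = n →
      ∃ v : List Bool, ∀ t : CantorSpace, f (u ++ₛ t) = v ++ₛ t := by
  constructor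
  · rintro ⟨P, Q, hP, -, hPm, -, β, hβ⟩
    obtain ⟨n, hn⟩ := (hP.image List.length).bddAbove
    refine ⟨n, fun u hu => ?_⟩
    obtain ⟨p, hp, h⟩ := ((isMaximalPrefixCode_iff P).1 hPm).2 u
    have hpn : p.length ≤ n := hn ⟨p, hp, rfl⟩
    have hpu : p <+: u := by
      rcases h with h | h
      · exact h
      · rw [h.eq_of_length_le (by omega)]
    obtain ⟨r, rfl⟩ := hpu
    refine ⟨(β ⟨p, hp⟩).1 ++ r, fun t => ?_⟩
    rw [Stream'.append_append_stream, Stream'.append_append_stream]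
    exact hβ ⟨p, hp⟩ (r ++ₛ t)
  · rintro ⟨n, hn⟩
    choose! v hv using hn
    have key : ∀ u u' : List Bool, u.length = n → u'.length = n → v u <+: v u' → u = u' := by
      rintro u u' hu hu' ⟨r, hr⟩
      have h : f (u' ++ₛ Stream'.const false) = f (u ++ₛ (r ++ₛ Stream'.const false)) := by
        rw [hv u' hu', hv u hu, ← hr, Stream'.append_append_stream]
      exact (prefix_of_append_stream_eq (f.injective h).symm (by omega)).eq_of_length (by omega)
    have hfin : {u : List Bool | u.length = n}.Finite := List.finite_length_eq Bool n
    have hinj : Set.InjOn v {u : List Bool | u.length = n} := fun u hu u' hu' h =>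
      key u u' hu hu' (h ▸ List.prefix_refl _)
    refine ⟨{u | u.length = n}, v '' {u | u.length = n}, hfin, hfin.image v, ?_, ?_,
      Equiv.Set.imageOfInjOn v _ hinj, fun p t => hv p.1 p.2 t⟩
    · refine (isMaximalPrefixCode_iff _).2 ⟨fun p hp q hq h => ?_, fun u => ?_⟩
      · exact h.eq_of_length (hp.trans hq.symm)
      · obtain ⟨p, t, hp, h⟩ := append_stream_take n (u ++ₛ Stream'.const false)
        refine ⟨p, hp, ?_⟩
        rcases le_total p.length u.length with hl | hl
        · exact Or.inl (prefix_of_append_stream_eq h.symm hl)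
        · exact Or.inr (prefix_of_append_stream_eq h hl)
    · refine (isMaximalPrefixCode_iff _).2 ⟨?_, fun u => ?_⟩
      · rintro _ ⟨p, hp, rfl⟩ _ ⟨q, hq, rfl⟩ h
        rw [key p q hp hq h]
      · obtain ⟨p, t, hp, h⟩ := append_stream_take n (f.symm (u ++ₛ Stream'.const false))
        have h' : u ++ₛ Stream'.const false = v p ++ₛ t := by
          rw [← hv p hp, ← h, Equiv.apply_symm_apply]
        refine ⟨v p, ⟨p, hp, rfl⟩, ?_⟩
        rcases le_total (v p).length u.length with hl | hl
        · exact Or.inl (prefix_of_append_stream_eq h'.symm hl)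
        · exact Or.inr (prefix_of_append_stream_eq h' hl)

/-- The Thompson group `V`, as a group of permutations of the Cantor space: the permutations that
are given by a finite table. It acts on the left; `(f * g) x = f (g x)`. -/
def thompsonV : Subgroup (Equiv.Perm CantorSpace) where
  carrier := {f | HasPrefixTable f}
  one_mem' := (hasPrefixTable_iff 1).2 ⟨0, fun u _ => ⟨u, fun _ => rfl⟩⟩
  inv_mem' := by
    rintro f ⟨P, Q, hP, hQ, hPm, hQm, β, hβ⟩
    refine ⟨Q, P, hQ, hP, hQm, hPm, β.symm, fun q t => ?_⟩
    rw [Equiv.Perm.inv_eq_iff_eq, hβ, Equiv.apply_symm_apply]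
  mul_mem' := by
    intro f g hf hg
    obtain ⟨m, hm⟩ := (hasPrefixTable_iff f).1 hf
    obtain ⟨n, hn⟩ := (hasPrefixTable_iff g).1 hg
    refine (hasPrefixTable_iff (f * g)).2 ⟨n + m, fun u hu => ?_⟩
    obtain ⟨v, hv⟩ := hn (u.take n) (by simp; omega)
    obtain ⟨c, hc⟩ := hm ((v ++ u.drop n).take m) (by simp; omega)
    refine ⟨c ++ (v ++ u.drop n).drop m, fun t => ?_⟩
    have h1 : g (u ++ₛ t) = (v ++ u.drop n) ++ₛ t := by
      conv_lhs => rw [← List.take_append_drop n u]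
      rw [Stream'.append_append_stream, hv, Stream'.append_append_stream]
    rw [Equiv.Perm.mul_apply, h1]
    conv_lhs => rw [← List.take_append_drop m (v ++ u.drop n)]
    rw [Stream'.append_append_stream, hc, Stream'.append_append_stream]

/-! ### Word problems -/

/-- The element of `G` represented by a word over the alphabet `Γ ⊆ G`. -/
def wordElement {G : Type*} [Group G] {Γ : Finset G} (w : List Γ) : G :=
  (w.map Subtype.val).prod

/-- `Γ` is a finite monoid generating set of the group `G`: every element of `G` is a product of a
finite sequence of elements of `Γ`. -/
def IsMonoidGeneratingSet {G : Type*} [Group G] (Γ : Finset G) : Prop :=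
  ∀ g : G, ∃ w : List Γ, wordElement w = g

/-- The word problem of `G` over `Γ`. -/
def wordProblem {G : Type*} [Group G] (Γ : Finset G) : Language Γ :=
  {w : List Γ | wordElement w = 1}

/-- The co-word-problem of `G` over `Γ`: the complement in `Γ^*` of the word problem. -/
def coWordProblem {G : Type*} [Group G] (Γ : Finset G) : Language Γ :=
  (wordProblem Γ)ᶜ

/-- The infinite bit-string `z 0^ω`. -/
def padZeros (z : List Bool) : CantorSpace :=
  z ++ₛ Stream'.const false

/-- The language `L_z` of all nonempty words over `Γ` whose action moves `z 0^ω`. -/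
def movingLanguage (Γ : Finset thompsonV) (z : List Bool) : Language Γ :=
  {w : List Γ | w ≠ [] ∧
    ((wordElement w : thompsonV) : Equiv.Perm CantorSpace) (padZeros z) ≠ padZeros z}

/-! ### Deterministic context-free languages -/

/-- A transition `(source, pop) → (target, push)` of a push-down automaton with states `Q`, input
alphabet `A` and stack alphabet `S`. It reads the letter `a` if `letter = some a` and no input if
`letter = none`. The top of the stack is the head of a list. -/
structure PDATransition (Q A S : Type*) where
  source : Q
  pop : List S
  letter : Option A
  target : Q
  push : List S
  pop_ne_nil : pop ≠ []

/-- A push-down automaton with input alphabet `A`. -/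
structure PDA (A : Type*) where
  State : Type
  Stack : Type
  finiteState : Finite State
  finiteStack : Finite Stack
  transitions : Set (PDATransition State A Stack)
  finiteTransitions : transitions.Finite
  startState : State
  startStack : List Stack
  startStack_ne_nil : startStack ≠ []
  accept : Set State

/-- A configuration: the input that has been read so far, the state, and the stack content. -/
structure PDAConfig {A : Type*} (M : PDA A) where
  read : List A
  state : M.State
  stack : List M.Stack

/-- Applicability of a transition in state `q` with stack content `s`, where `next` is the next
input letter (`none` if the end of the input has been reached). -/
def PDATransition.Applicable {Q A S : Type*} (τ : PDATransition Q A S) (q : Q) (s : List S)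
    (next : Option A) : Prop :=
  τ.source = q ∧ τ.pop <+: s ∧ (τ.letter = none ∨ τ.letter = next)

/-- One computation step: apply a transition to a configuration. -/
inductive PDA.Step {A : Type*} (M : PDA A) : PDAConfig M → PDAConfig M → Prop
  | apply (τ : PDATransition M.State A M.Stack) (hτ : τ ∈ M.transitions) (w : List A)
      (t : List M.Stack) :
      PDA.Step M ⟨w, τ.source, τ.pop ++ t⟩ ⟨w ++ τ.letter.toList, τ.target, τ.push ++ t⟩

/-- The language of the words `w` for which some computation from the start configuration reads
exactly `w` and ends in an accept state. -/
def PDA.language {A : Type*} (M : PDA A) : Language A :=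
  {w : List A | ∃ q ∈ M.accept, ∃ s : List M.Stack,
    Relation.ReflTransGen M.Step ⟨[], M.startState, M.startStack⟩ ⟨w, q, s⟩}

/-- Determinism: in every configuration, whatever the remaining input, at most one transition is
applicable. -/
def PDA.IsDeterministic {A : Type*} (M : PDA A) : Prop :=
  ∀ (q : M.State) (s : List M.Stack) (next : Option A),
    ∀ τ ∈ M.transitions, ∀ τ' ∈ M.transitions,
      τ.Applicable q s next → τ'.Applicable q s next → τ = τ'

/-- A language is deterministic context-free if a deterministic push-down automaton accepts it. -/
def IsDeterministicContextFree {A : Type*} (L : Language A) : Prop :=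
  ∃ M : PDA A, M.IsDeterministic ∧ M.language = L

/-! ### Finite strings as eventually zero streams -/

/-! Prefix replacement keeps a stream eventually zero, and such a stream fits on a stack: its unique
trimmed representative above a bottom marker. As `Γ` is finite, one `N` serves all letters: each
replaces prefixes of length `N`, a bounded change at the top of the stack. Reversing a word feeds
its letters in the order in which they act, so the stack tracks the image of `padZeros z`.

The automaton inspects `N + 1` bits, or the whole content if it has at most `N` bits. These tops
form a prefix code (`eq_of_stackTop_prefix`), whence determinism. The extra bit means that trimming
is needed only when the whole content is visible (`replaceTop_spec`). With `z.length ≤ N`, one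
silent move after each letter decides whether the stream differs from `padZeros z`, so no endmarker
is needed. The invariant `IsFaithfulConfig` and the existence of a run on every word give the
language. -/

/-- A bit-string is trimmed if it does not end in `0`. -/
def IsTrimmed (t : List Bool) : Prop :=
  t.getLast? ≠ some false

/-- Removal of all trailing zeros. -/
def trimZeros (t : List Bool) : List Bool :=
  t.rdropWhile (!·)

theorem padZeros_append (u t : List Bool) : padZeros (u ++ t) = u ++ₛ padZeros t :=
  Stream'.append_append_stream _ _ _

theorem padZeros_replicate (n : ℕ) :
    padZeros (List.replicate n false) = Stream'.const false := by
  induction n with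
  | zero => rfl
  | succ n ih =>
    rw [List.replicate_succ, padZeros, Stream'.cons_append_stream]
    exact (congrArg (Stream'.cons false) ih).trans (Stream'.const_eq false).symm

theorem padZeros_append_replicate (t : List Bool) (n : ℕ) :
    padZeros (t ++ List.replicate n false) = padZeros t := by
  rw [padZeros_append, padZeros_replicate, padZeros]

theorem padZeros_trimZeros (t : List Bool) : padZeros (trimZeros t) = padZeros t := by
  induction t using List.reverseRecOn with
  | nil => rfl
  | append_singleton t b ih =>
    cases b with
    | false =>
      have h := padZeros_append_replicate t 1
      rw [List.replicate_one] at h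
      rw [h, ← ih, trimZeros, List.rdropWhile_concat_pos _ _ _ (by simp), trimZeros]
    | true => rw [trimZeros, List.rdropWhile_concat_neg _ _ _ (by simp)]

theorem isTrimmed_trimZeros (t : List Bool) : IsTrimmed (trimZeros t) := by
  induction t using List.reverseRecOn with
  | nil => simp [trimZeros, IsTrimmed]
  | append_singleton t b ih =>
    cases b with
    | false => rwa [trimZeros, List.rdropWhile_concat_pos _ _ _ (by simp)]
    | true =>
      rw [trimZeros, List.rdropWhile_concat_neg _ _ _ (by simp)]
      simp [IsTrimmed]

theorem length_trimZeros_le (t : List Bool) : (trimZeros t).length ≤ t.length :=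
  (List.rdropWhile_prefix _ t).length_le

theorem isTrimmed_append_iff {u t : List Bool} (ht : t ≠ []) :
    IsTrimmed (u ++ t) ↔ IsTrimmed t := by
  rw [IsTrimmed, IsTrimmed, List.getLast?_append, List.getLast?_eq_some_getLast ht, Option.some_or]

theorem IsTrimmed.tail {b : Bool} {t : List Bool} (h : IsTrimmed (b :: t)) : IsTrimmed t := by
  rcases eq_or_ne t [] with rfl | ht
  · simp [IsTrimmed]
  · exact (isTrimmed_append_iff (u := [b]) ht).1 h

theorem IsTrimmed.eq_nil {t : List Bool} (h : IsTrimmed t)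
    (h0 : padZeros t = Stream'.const false) : t = [] := by
  induction t with
  | nil => rfl
  | cons b t ih =>
    rw [Stream'.const_eq, padZeros, Stream'.cons_append_stream] at h0
    obtain ⟨rfl, h2⟩ := Stream'.cons_injective2 h0
    rw [ih h.tail h2] at h
    exact absurd rfl h

/-- Trimmed strings are canonical forms, so comparing streams reduces to comparing stack contents.
-/
theorem IsTrimmed.eq_of_padZeros_eq {s t : List Bool} (hs : IsTrimmed s) (ht : IsTrimmed t)
    (h : padZeros s = padZeros t) : s = t := by
  induction s generalizing t with
  | nil => exact (ht.eq_nil h.symm).symm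
  | cons a s ih =>
    cases t with
    | nil => exact hs.eq_nil h
    | cons b t =>
      rw [padZeros, padZeros, Stream'.cons_append_stream, Stream'.cons_append_stream] at h
      obtain ⟨rfl, h2⟩ := Stream'.cons_injective2 h
      rw [ih hs.tail ht.tail h2]

theorem IsTrimmed.eq_trimZeros_iff {s t : List Bool} (hs : IsTrimmed s) :
    s = trimZeros t ↔ padZeros s = padZeros t := by
  constructor
  · rintro rfl
    exact padZeros_trimZeros t
  · intro h
    exact hs.eq_of_padZeros_eq (isTrimmed_trimZeros t) (h.trans (padZeros_trimZeros t).symm)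

/-! ### A push-down automaton that performs prefix replacements

The stack alphabet is `Option Bool`, where `none` is the bottom marker. The stack content that
stands for the stream `padZeros t`, with `t` trimmed, is `t` followed by the bottom marker. -/

/-- The stack content that stands for the stream `padZeros t`. -/
def stackOf (t : List Bool) : List (Option Bool) :=
  t.map some ++ [none]

/-- The top of the stack that a transition inspects: at most `N` bits and the bottom marker, or
`N + 1` bits. -/
def stackTop (N : ℕ) (u : List Bool) : List (Option Bool) :=
  if u.length ≤ N then stackOf u else u.map some

theorem stackTop_ne_nil (N : ℕ) (u : List Bool) : stackTop N u ≠ [] := by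
  unfold stackTop stackOf
  split_ifs with h
  · simp
  · rintro h'
    rw [List.map_eq_nil_iff.1 h'] at h
    simp at h

theorem map_some_append_eq_stackOf {u t : List Bool} {s : List (Option Bool)}
    (h : u.map some ++ s = stackOf t) : ∃ r, t = u ++ r ∧ s = stackOf r := by
  induction u generalizing t with
  | nil => exact ⟨t, rfl, h⟩
  | cons b u ih =>
    cases t with
    | nil => simp [stackOf] at h
    | cons c t =>
      simp only [stackOf, List.map_cons, List.cons_append, List.cons.injEq,
        Option.some.injEq] at h
      obtain ⟨r, rfl, hr⟩ := ih h.2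
      exact ⟨r, by rw [h.1]; rfl, hr⟩

theorem stackOf_append_eq_stackOf {u t : List Bool} {s : List (Option Bool)}
    (h : stackOf u ++ s = stackOf t) : u = t ∧ s = [] := by
  rw [stackOf, List.append_assoc] at h
  obtain ⟨r, rfl, hr⟩ := map_some_append_eq_stackOf h
  cases r with
  | nil => simpa [stackOf] using hr
  | cons b r => simp [stackOf] at hr

/-- The bottom marker occurs only at the end of a top, and tops without it all have exactly `N + 1`
symbols. -/
theorem eq_of_stackTop_prefix {N : ℕ} {u v : List Bool} (hu : u.length ≤ N + 1)
    (hv : v.length ≤ N + 1) (h : stackTop N u <+: stackTop N v) : u = v := by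
  obtain ⟨s, hs⟩ := h
  unfold stackTop at hs
  split_ifs at hs with h1 h2 h2
  · exact (stackOf_append_eq_stackOf hs).1
  · have : (none : Option Bool) ∈ v.map some := by simp [← hs, stackOf]
    simp at this
  · obtain ⟨r, rfl, -⟩ := map_some_append_eq_stackOf hs
    simp at h2
    omega
  · have hp : u.map some <+: v.map some := ⟨s, hs⟩
    exact List.map_injective_iff.2 (Option.some_injective Bool)
      (hp.eq_of_length (by simp; omega))

theorem exists_stackTop_append (N : ℕ) (t : List Bool) :
    ∃ u s, u.length ≤ N + 1 ∧ stackOf t = stackTop N u ++ s := by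
  rcases le_or_gt t.length N with h | h
  · exact ⟨t, [], by omega, by simp [stackTop, h]⟩
  · refine ⟨t.take (N + 1), stackOf (t.drop (N + 1)), by simp, ?_⟩
    have h' : ¬ (t.take (N + 1)).length ≤ N := by simp; omega
    rw [stackTop, if_neg h', stackOf, stackOf, ← List.append_assoc, ← List.map_append,
      List.take_append_drop]

variable {A : Type*}

/-- What replaces `stackTop N u` when a letter is read that replaces each prefix `p` of length `N`
by `v p`. -/
def replaceTop (N : ℕ) (v : List Bool → List Bool) (u : List Bool) : List (Option Bool) :=
  if u.length ≤ N then stackOf (trimZeros (v (u ++ List.replicate (N - u.length) false)))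
  else (v (u.take N) ++ u.drop N).map some

/-- A short content is padded with zeros to length `N`, replaced and trimmed at once. In a long one
the last bit lies beyond the replaced prefix and survives. -/
theorem replaceTop_spec {N : ℕ} {v : List Bool → List Bool} {f : CantorSpace → CantorSpace}
    (hf : ∀ p : List Bool, p.length = N → ∀ x : CantorSpace, f (p ++ₛ x) = v p ++ₛ x)
    {t u : List Bool} {s : List (Option Bool)} (ht : IsTrimmed t)
    (h : stackTop N u ++ s = stackOf t) :
    ∃ t', IsTrimmed t' ∧ replaceTop N v u ++ s = stackOf t' ∧ padZeros t' = f (padZeros t) := by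
  unfold stackTop at h
  unfold replaceTop
  split_ifs at h ⊢ with hu
  · obtain ⟨rfl, rfl⟩ := stackOf_append_eq_stackOf h
    refine ⟨_, isTrimmed_trimZeros _, List.append_nil _, ?_⟩
    rw [padZeros_trimZeros, ← padZeros_append_replicate u (N - u.length)]
    exact (hf _ (by simp; omega) _).symm
  · obtain ⟨r, rfl, rfl⟩ := map_some_append_eq_stackOf h
    -- Here `u` has more than `N` bits, so the old nonempty tail still ends the new string and keeps
    -- it trimmed.
    have hne : u.drop N ++ r ≠ [] := by
      intro h0
      have := congrArg List.length h0
      simp at this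
      omega
    refine ⟨v (u.take N) ++ (u.drop N ++ r), ?_, by simp [stackOf], ?_⟩
    · rw [isTrimmed_append_iff hne]
      rwa [← List.take_append_drop N u, List.append_assoc, isTrimmed_append_iff hne] at ht
    · rw [padZeros_append, ← hf _ (by simp; omega), ← padZeros_append, ← List.append_assoc,
        List.take_append_drop]

/-- The transition that reads the letter `a` and replaces the prefix. -/
def readTransition (N : ℕ) (v : A → List Bool → List Bool) (a : A) (b : Bool) (u : List Bool) :
    PDATransition (Option Bool) A (Option Bool) where
  source := some b
  pop := stackTop N u
  letter := some a
  target := none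
  push := replaceTop N (v a) u
  pop_ne_nil := stackTop_ne_nil N u

/-- The transition that compares the stack content with `z`. -/
def checkTransition (N : ℕ) (z : List Bool) (u : List Bool) :
    PDATransition (Option Bool) A (Option Bool) where
  source := none
  pop := stackTop N u
  letter := none
  target := some (decide (u ≠ trimZeros z))
  push := stackTop N u
  pop_ne_nil := stackTop_ne_nil N u

/-- The push-down automaton that starts with `padZeros z` on its stack, reads letters that replace
prefixes of length `N` according to `v`, and accepts if the resulting stream is not `padZeros z`.
After each letter it is in the state `none`; the states `some b` hold the outcome of the
comparison. -/
def prefixReplacementPDA [Finite A] (N : ℕ) (v : A → List Bool → List Bool) (z : List Bool) :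
    PDA A where
  State := Option Bool
  Stack := Option Bool
  finiteState := inferInstance
  finiteStack := inferInstance
  transitions :=
    (⋃ a, ⋃ b, readTransition N v a b '' {u | u.length ≤ N + 1}) ∪
      checkTransition N z '' {u | u.length ≤ N + 1}
  finiteTransitions :=
    (Set.finite_iUnion fun _ => Set.finite_iUnion fun _ =>
      (List.finite_length_le Bool (N + 1)).image _).union
      ((List.finite_length_le Bool (N + 1)).image _)
  startState := some false
  startStack := stackOf (trimZeros z)
  startStack_ne_nil := by simp [stackOf]
  accept := {some true}

/-! ### Determinism and correctness of the automaton -/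

section

variable [Finite A] {N : ℕ} {v : A → List Bool → List Bool} {z : List Bool}

theorem mem_prefixReplacementPDA_transitions
    {τ : PDATransition (Option Bool) A (Option Bool)} :
    τ ∈ (prefixReplacementPDA N v z).transitions ↔
      (∃ a b u, u.length ≤ N + 1 ∧ readTransition N v a b u = τ) ∨
        ∃ u, u.length ≤ N + 1 ∧ checkTransition N z u = τ :=
  or_congr (Set.mem_iUnion.trans (exists_congr fun _ => Set.mem_iUnion)) Iff.rfl

/-- The state separates reading moves from silent ones; the prefix code property and the next letter
determine the rest. -/
theorem isDeterministic_prefixReplacementPDA :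
    (prefixReplacementPDA N v z).IsDeterministic := by
  rintro q s next τ hτ τ' hτ' ⟨h1, h2, h3⟩ ⟨h1', h2', h3'⟩
  have key : ∀ u u' : List Bool, u.length ≤ N + 1 → u'.length ≤ N + 1 →
      stackTop N u <+: s → stackTop N u' <+: s → u = u' := by
    intro u u' hu hu' h h'
    rcases List.prefix_or_prefix_of_prefix h h' with h | h
    · exact eq_of_stackTop_prefix hu hu' h
    · exact (eq_of_stackTop_prefix hu' hu h).symm
  rcases mem_prefixReplacementPDA_transitions.1 hτ with ⟨a, b, u, hu, rfl⟩ | ⟨u, hu, rfl⟩ <;>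
    rcases mem_prefixReplacementPDA_transitions.1 hτ' with
      ⟨a', b', u', hu', rfl⟩ | ⟨u', hu', rfl⟩
  · obtain rfl := key u u' hu hu' h2 h2'
    obtain rfl : b = b' := Option.some_injective _ (h1.trans h1'.symm)
    have h4 : some a = next := h3.resolve_left (Option.some_ne_none a)
    have h4' : some a' = next := h3'.resolve_left (Option.some_ne_none a')
    obtain rfl : a = a' := Option.some_injective _ (h4.trans h4'.symm)
    rfl
  · exact absurd (h1.trans h1'.symm) (Option.some_ne_none b)
  · exact absurd (h1'.trans h1.symm) (Option.some_ne_none b')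
  · obtain rfl := key u u' hu hu' h2 h2'
    rfl

/-- `c` is a configuration that `prefixReplacementPDA N v z` may have when the letters act by
`f`. -/
def IsFaithfulConfig (f : A → CantorSpace → CantorSpace)
    (c : PDAConfig (prefixReplacementPDA N v z)) : Prop :=
  ∃ t, IsTrimmed t ∧ c.stack = stackOf t ∧
    padZeros t = c.read.foldl (fun x a => f a x) (padZeros z) ∧
    ∀ b : Bool, c.state = some b → (b = true ↔ padZeros t ≠ padZeros z)

variable {f : A → CantorSpace → CantorSpace}

theorem IsFaithfulConfig.step (hz : z.length ≤ N)
    (hf : ∀ a p, p.length = N → ∀ x : CantorSpace, f a (p ++ₛ x) = v a p ++ₛ x)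
    {c c' : PDAConfig (prefixReplacementPDA N v z)} (hc : IsFaithfulConfig f c)
    (h : (prefixReplacementPDA N v z).Step c c') : IsFaithfulConfig f c' := by
  obtain ⟨τ, hτ, w, (s : List (Option Bool))⟩ := h
  obtain ⟨t, ht, hs, hw, -⟩ := hc
  rcases mem_prefixReplacementPDA_transitions.1 hτ with ⟨a, b, u, hu, rfl⟩ | ⟨u, hu, rfl⟩
  · obtain ⟨t', ht', hs', hp⟩ := replaceTop_spec (hf a) ht hs
    -- The target state `none` carries no verdict, so the last clause is vacuous.
    refine ⟨t', ht', hs', ?_, fun b hb => absurd hb.symm (Option.some_ne_none b)⟩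
    rw [hp, hw]
    exact (List.foldl_concat (fun x a => f a x) _ a w).symm
  · refine ⟨t, ht, hs, hw.trans ?_, fun b hb => ?_⟩
    · exact congrArg (List.foldl (fun x a => f a x) (padZeros z)) (List.append_nil w).symm
    · obtain rfl : decide (u ≠ trimZeros z) = b := Option.some_injective _ hb
      rw [decide_eq_true_iff, not_iff_not, ← ht.eq_trimZeros_iff]
      change stackTop N u ++ (s : List (Option Bool)) = stackOf t at hs
      unfold stackTop at hs
      split_ifs at hs with hN
      · rw [(stackOf_append_eq_stackOf hs).1]
      -- A top without marker has more than `N ≥ z.length` bits: both the top and the full content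
      -- differ from `trimZeros z`.
      · obtain ⟨r, rfl, -⟩ := map_some_append_eq_stackOf hs
        have := length_trimZeros_le z
        constructor
        · rintro rfl
          omega
        · intro h
          have := congrArg List.length h
          simp at this
          omega

theorem isFaithfulConfig_of_reflTransGen (hz : z.length ≤ N)
    (hf : ∀ a p, p.length = N → ∀ x : CantorSpace, f a (p ++ₛ x) = v a p ++ₛ x)
    {c : PDAConfig (prefixReplacementPDA N v z)}
    (h : Relation.ReflTransGen (prefixReplacementPDA N v z).Step
      ⟨[], some false, stackOf (trimZeros z)⟩ c) : IsFaithfulConfig f c := by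
  induction h with
  | refl =>
    refine ⟨trimZeros z, isTrimmed_trimZeros z, rfl, padZeros_trimZeros z, fun b hb => ?_⟩
    obtain rfl : false = b := Option.some_injective _ hb
    simp [padZeros_trimZeros]
  | tail _ h ih => exact ih.step hz hf h

/-- The automaton never gets stuck: by the invariant the stack always has the form `stackOf t`,
which begins with an admissible top. -/
theorem exists_reflTransGen_prefixReplacementPDA (hz : z.length ≤ N)
    (hf : ∀ a p, p.length = N → ∀ x : CantorSpace, f a (p ++ₛ x) = v a p ++ₛ x) (w : List A) :
    ∃ (b : Bool) (s : List (Option Bool)),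
      Relation.ReflTransGen (prefixReplacementPDA N v z).Step
        ⟨[], some false, stackOf (trimZeros z)⟩ ⟨w, some b, s⟩ := by
  induction w using List.reverseRecOn with
  | nil => exact ⟨false, _, .refl⟩
  | append_singleton w a ih =>
    obtain ⟨b, s, h⟩ := ih
    obtain ⟨t, -, rfl, -, -⟩ := isFaithfulConfig_of_reflTransGen hz hf h
    obtain ⟨u, s, hu, hs⟩ := exists_stackTop_append N t
    rw [hs] at h
    have h1 := h.tail (PDA.Step.apply (readTransition N v a b u)
      (mem_prefixReplacementPDA_transitions.2 (.inl ⟨a, b, u, hu, rfl⟩)) w s)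
    obtain ⟨t', -, hs', -, -⟩ := isFaithfulConfig_of_reflTransGen hz hf h1
    change replaceTop N (v a) u ++ s = stackOf t' at hs'
    obtain ⟨u', s', hu', hs''⟩ := exists_stackTop_append N t'
    change Relation.ReflTransGen (prefixReplacementPDA N v z).Step _
      ⟨w ++ [a], none, replaceTop N (v a) u ++ s⟩ at h1
    rw [hs', hs''] at h1
    have h2 := h1.tail (PDA.Step.apply (checkTransition N z u')
      (mem_prefixReplacementPDA_transitions.2 (.inr ⟨u', hu', rfl⟩)) (w ++ [a]) s')
    change Relation.ReflTransGen (prefixReplacementPDA N v z).Step _ ⟨w ++ [a] ++ [], _, _⟩ at h2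
    rw [List.append_nil] at h2
    exact ⟨_, _, h2⟩

theorem language_prefixReplacementPDA (hz : z.length ≤ N)
    (hf : ∀ a p, p.length = N → ∀ x : CantorSpace, f a (p ++ₛ x) = v a p ++ₛ x) :
    (prefixReplacementPDA N v z).language =
      {w : List A | w.foldl (fun x a => f a x) (padZeros z) ≠ padZeros z} := by
  ext w
  constructor
  · rintro ⟨q, hq, s, h⟩
    obtain ⟨t, -, -, hw, hb⟩ := isFaithfulConfig_of_reflTransGen hz hf h
    have := (hb true hq).1 rfl
    rwa [hw] at this
  · intro hw
    obtain ⟨b, s, h⟩ := exists_reflTransGen_prefixReplacementPDA hz hf w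
    obtain ⟨t, -, -, hw', hb⟩ := isFaithfulConfig_of_reflTransGen hz hf h
    -- The run ends in a state with a verdict, which the invariant forces to be the correct one.
    obtain rfl : b = true := (hb b rfl).2 (by rw [hw']; exact hw)
    exact ⟨some true, rfl, s, h⟩

end

/-- If finitely many letters act on streams by replacing prefixes of bounded length, then the words
that move `padZeros z`, where the first letter acts first, form a deterministic context-free
language. -/
theorem isDeterministicContextFree_foldl_ne [Finite A] (f : A → CantorSpace → CantorSpace)
    (hf : ∀ a, ∃ n : ℕ, ∀ u : List Bool, u.length = n →
      ∃ v : List Bool, ∀ t : CantorSpace, f a (u ++ₛ t) = v ++ₛ t) (z : List Bool) :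
    IsDeterministicContextFree
      {w : List A | w.foldl (fun x a => f a x) (padZeros z) ≠ padZeros z} := by
  choose n hn using hf
  obtain ⟨m, hm⟩ := (Set.finite_range n).bddAbove
  -- The bound `m` makes the prefix length uniform over the letters; `z.length` is needed for the
  -- comparison with `z`.
  have hN : ∀ a (p : List Bool), p.length = max m z.length →
      ∃ q : List Bool, ∀ x : CantorSpace, f a (p ++ₛ x) = q ++ₛ x := by
    intro a p hp
    have ha : n a ≤ m := hm ⟨a, rfl⟩
    obtain ⟨q, hq⟩ := hn a (p.take (n a)) (by simp; omega)
    refine ⟨q ++ p.drop (n a), fun x => ?_⟩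
    rw [Stream'.append_append_stream, ← hq, ← Stream'.append_append_stream,
      List.take_append_drop]
  choose! v hv using hN
  exact ⟨prefixReplacementPDA (max m z.length) v z, isDeterministic_prefixReplacementPDA,
    language_prefixReplacementPDA (le_max_right _ _) hv⟩

/-! ### Reversed words over `Γ` -/

theorem wordElement_reverse_apply {Γ : Finset thompsonV} (w : List Γ) (x : CantorSpace) :
    ((wordElement w.reverse : thompsonV) : Equiv.Perm CantorSpace) x =
      w.foldl (fun x a => (a.1 : Equiv.Perm CantorSpace) x) x := by
  induction w generalizing x with
  | nil => rfl
  | cons a w ih =>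
    rw [List.foldl_cons, ← ih]
    simp [wordElement]

/-- Nonemptiness may be dropped, since the empty word moves nothing. -/
theorem movingLanguage_reverse (Γ : Finset thompsonV) (z : List Bool) :
    (movingLanguage Γ z).reverse =
      {w : List Γ | w.foldl (fun x a => (a.1 : Equiv.Perm CantorSpace) x) (padZeros z) ≠
        padZeros z} := by
  ext w
  rw [Language.mem_reverse]
  change w.reverse ≠ [] ∧ _ ≠ _ ↔ _ ≠ _
  rw [wordElement_reverse_apply, and_iff_right_iff_imp]
  rintro h h'
  rw [List.reverse_eq_nil_iff.1 h'] at h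
  exact h rfl

theorem movingLanguage_le_coWordProblem (Γ : Finset thompsonV) (z : List Bool) :
    movingLanguage Γ z ≤ coWordProblem Γ := by
  rintro w ⟨-, hw⟩ (h : wordElement w = 1)
  exact hw (by rw [h]; rfl)

theorem mainTheorem3 (Γ : Finset thompsonV) (hΓ : IsMonoidGeneratingSet Γ)
    (z : List Bool) (hz : z ≠ []) :
    movingLanguage Γ z ≤ coWordProblem Γ ∧
      IsDeterministicContextFree (movingLanguage Γ z).reverse := by
  refine ⟨movingLanguage_le_coWordProblem Γ z, ?_⟩
  rw [movingLanguage_reverse]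
  exact isDeterministicContextFree_foldl_ne _ (fun a => (hasPrefixTable_iff _).1 a.1.2) z
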